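/- \textbf{Theorem (Noninterference for DCC).} Let $(\mathcal L,\sqsubseteq)$ be a lattice. Consider the dependency core calculus without fixpoints, with booleans: the simply typed $\lambda$-calculus with types $$A,B ::= \mathsf{unit}\mid \mathsf{Bool}\mid A\times B\mid A\to B\mid T_\ell A\qquad(\ell\in\mathcal L),$$ with the usual terms for $\mathsf{unit}$, products and functions, the constants $\mathtt{tt},\mathtt{ff}:\mathsf{Bool}$, the conditional $\mathsf{if}\ M\ \mathsf{then}\ P\ \mathsf{else}\ Q : C$ (for $M:\mathsf{Bool}$ and $P,Q:C$, any type $C$), and the rules $$\frac{\Gamma\vdash M:A}{\Gamma\vdash[M]_\ell:T_\ell A}\qquad \frac{\Gamma\vdash M:T_\ell A\quad \Gamma,x:A\vdash N:B\quad B\text{ is protected at }\ell}{\Gamma\vdash \mathsf{let}\ x=M\ \mathsf{in}\ N:B}.$$ Here "protected at" is the least relation such that (I) if $\ell'\sqsubseteq\ell$ then $T_\ell A$ is protected at $\ell'$; (II) if $A$ is protected at $\ell$ then so is $T_{\ell'}A$ for every $\ell'$; (III) if $A,B$ are protected at $\ell$ then so are $A\times B$ and $C\to A$ for every type $C$. The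 equality judgement $\Gamma\vdash M=N:A$ is the least congruence on well-typed terms that contains the $\beta$ and $\eta$ equations for $\mathsf{unit}$, products and functions, the equations $(\mathsf{if}\ \mathtt{tt}\ \mathsf{then}\ P\ \mathsf{else}\ Q)=P$ and $(\mathsf{if}\ \mathtt{ff}\ \mathsf{then}\ P\ \mathsf{else}\ Q)=Q$, and the monadic equations $(\mathsf{let}\ x=[M]_\ell\ \mathsf{in}\ N)=N[M/x]$, $(\mathsf{let}\ x=M\ \mathsf{in}\ [x]_\ell)=M$ for $M:T_\ell A$, and $(\mathsf{let}\ y=(\mathsf{let}\ x=M\ \mathsf{in}\ N)\ \mathsf{in}\ P)=(\mathsf{let}\ x=M\ \mathsf{in}\ \mathsf{let}\ y=N\ \mathsf{in}\ P)$ with $x$ not free in $P$, whenever both sides are well typed. Let $A$ be a non-empty type, i.e. there is a closed term of type $A$, let $\ell,\ell'\in\mathcal L$ with $\ell\not\sqsubseteq\ell'$, and let $x:T_\ell A\vdash M:T_{\ell'}\mathsf{Bool}$. Then for all closed terms $\vdash E,E':T_\ell A$, $$\vdash M[E/x]=M[E'/x]:T_{\ell'}\mathsf{Bool}.$$ -/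

import Mathlib

namespace DCC

universe u

/-- Types of the recursion-free dependency core calculus with booleans over a set `L` of labels. -/
inductive Ty (L : Type u) : Type u
  | unit : Ty L
  | bool : Ty L
  | prod : Ty L → Ty L → Ty L
  | arrow : Ty L → Ty L → Ty L
  /-- the type `T_ℓ A` -/
  | T : L → Ty L → Ty L

/-- `Protected ℓ A`: the type `A` is protected at level `ℓ`. -/
inductive Protected {L : Type u} [LE L] : L → Ty L → Prop
  | level {ℓ ℓ' : L} {A : Ty L} : ℓ' ≤ ℓ → Protected ℓ' (Ty.T ℓ A)
  | inner {ℓ ℓ' : L} {A : Ty L} : Protected ℓ A → Protected ℓ (Ty.T ℓ' A)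
  | prod {ℓ : L} {A B : Ty L} : Protected ℓ A → Protected ℓ B → Protected ℓ (Ty.prod A B)
  | arrow {ℓ : L} {C A : Ty L} : Protected ℓ A → Protected ℓ (Ty.arrow C A)

/-- Typing contexts; the most recently bound variable comes first. -/
abbrev Ctx (L : Type u) : Type u := List (Ty L)

/-- `Var Γ A`: a (de Bruijn) variable of type `A` in the context `Γ`. -/
inductive Var {L : Type u} : Ctx L → Ty L → Type u
  | zero {Γ : Ctx L} {A : Ty L} : Var (A :: Γ) A
  | succ {Γ : Ctx L} {A B : Ty L} : Var Γ A → Var (B :: Γ) A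

/-- `Tm Γ A`: the terms `M` with `Γ ⊢ M : A`, up to renaming of bound variables. -/
inductive Tm {L : Type u} [LE L] : Ctx L → Ty L → Type u
  | var {Γ : Ctx L} {A : Ty L} : Var Γ A → Tm Γ A
  | star {Γ : Ctx L} : Tm Γ Ty.unit
  | tt {Γ : Ctx L} : Tm Γ Ty.bool
  | ff {Γ : Ctx L} : Tm Γ Ty.bool
  /-- `ite M P Q` is `if M then P else Q` -/
  | ite {Γ : Ctx L} {C : Ty L} : Tm Γ Ty.bool → Tm Γ C → Tm Γ C → Tm Γ C
  | pair {Γ : Ctx L} {A B : Ty L} : Tm Γ A → Tm Γ B → Tm Γ (Ty.prod A B)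
  | fst {Γ : Ctx L} {A B : Ty L} : Tm Γ (Ty.prod A B) → Tm Γ A
  | snd {Γ : Ctx L} {A B : Ty L} : Tm Γ (Ty.prod A B) → Tm Γ B
  | lam {Γ : Ctx L} {A B : Ty L} : Tm (A :: Γ) B → Tm Γ (Ty.arrow A B)
  | app {Γ : Ctx L} {A B : Ty L} : Tm Γ (Ty.arrow A B) → Tm Γ A → Tm Γ B
  /-- `ret ℓ M` is `[M]_ℓ` -/
  | ret {Γ : Ctx L} {A : Ty L} (ℓ : L) : Tm Γ A → Tm Γ (Ty.T ℓ A)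
  /-- `bind h M N` is `let x = M in N`, whose type has to be protected at the level of `M` -/
  | bind {Γ : Ctx L} {ℓ : L} {A B : Ty L} :
      Protected ℓ B → Tm Γ (Ty.T ℓ A) → Tm (A :: Γ) B → Tm Γ B

section Substitution

variable {L : Type u}

/-- Renamings of the variables of `Γ` by variables of `Δ`. -/
abbrev Ren (Γ Δ : Ctx L) : Type u := ∀ A : Ty L, Var Γ A → Var Δ A

/-- Extend a renaming under a binder. -/
def Ren.lift {Γ Δ : Ctx L} (ρ : Ren Γ Δ) (B : Ty L) : Ren (B :: Γ) (B :: Δ)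
  | _, Var.zero => Var.zero
  | A, Var.succ v => Var.succ (ρ A v)

variable [LE L]

def Tm.rename {Γ Δ : Ctx L} {A : Ty L} (ρ : Ren Γ Δ) : Tm Γ A → Tm Δ A
  | .var v => .var (ρ _ v)
  | .star => .star
  | .tt => .tt
  | .ff => .ff
  | .ite M P Q => .ite (M.rename ρ) (P.rename ρ) (Q.rename ρ)
  | .pair M N => .pair (M.rename ρ) (N.rename ρ)
  | .fst M => .fst (M.rename ρ)
  | .snd M => .snd (M.rename ρ)
  | .lam M => .lam (M.rename (ρ.lift _))
  | .app M N => .app (M.rename ρ) (N.rename ρ)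
  | .ret ℓ M => .ret ℓ (M.rename ρ)
  | .bind h M N => .bind h (M.rename ρ) (N.rename (ρ.lift _))

/-- The renaming that adds one fresh variable. -/
def Ren.wk {Γ : Ctx L} (B : Ty L) : Ren Γ (B :: Γ) := fun _ v => Var.succ v

/-- Weakening of a term by one fresh variable. -/
def Tm.weaken {Γ : Ctx L} {A : Ty L} (B : Ty L) (M : Tm Γ A) : Tm (B :: Γ) A :=
  M.rename (Ren.wk B)

/-- Simultaneous substitutions of terms over `Δ` for the variables of `Γ`. -/
abbrev Sub (Γ Δ : Ctx L) : Type u := ∀ A : Ty L, Var Γ A → Tm Δ A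

/-- Extend a substitution under a binder. -/
def Sub.lift {Γ Δ : Ctx L} (σ : Sub Γ Δ) (B : Ty L) : Sub (B :: Γ) (B :: Δ)
  | _, Var.zero => Tm.var Var.zero
  | A, Var.succ v => (σ A v).weaken B

/-- Simultaneous capture-avoiding substitution. -/
def Tm.subst {Γ Δ : Ctx L} {A : Ty L} (σ : Sub Γ Δ) : Tm Γ A → Tm Δ A
  | .var v => σ _ v
  | .star => .star
  | .tt => .tt
  | .ff => .ff
  | .ite M P Q => .ite (M.subst σ) (P.subst σ) (Q.subst σ)
  | .pair M N => .pair (M.subst σ) (N.subst σ)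
  | .fst M => .fst (M.subst σ)
  | .snd M => .snd (M.subst σ)
  | .lam M => .lam (M.subst (σ.lift _))
  | .app M N => .app (M.subst σ) (N.subst σ)
  | .ret ℓ M => .ret ℓ (M.subst σ)
  | .bind h M N => .bind h (M.subst σ) (N.subst (σ.lift _))

/-- The substitution `[E/x]` for the most recent variable `x`. -/
def Sub.single {Γ : Ctx L} {B : Ty L} (E : Tm Γ B) : Sub (B :: Γ) Γ
  | _, Var.zero => E
  | _, Var.succ v => Tm.var v

/-- `M.inst E` is `M[E/x]`, where `x` is the most recent variable. -/
def Tm.inst {Γ : Ctx L} {A B : Ty L} (M : Tm (B :: Γ) A) (E : Tm Γ B) : Tm Γ A :=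
  M.subst (Sub.single E)

end Substitution

/-- `TmEq M N` is the judgement `Γ ⊢ M = N : A`: the least congruence that contains the usual
equations of the simply typed lambda calculus with unit and products, the two computation rules
of the booleans, and the three equations of the monadic metalanguage. -/
inductive TmEq {L : Type u} [LE L] : {Γ : Ctx L} → {A : Ty L} → Tm Γ A → Tm Γ A → Prop
  -- equivalence relation
  | refl {Γ : Ctx L} {A : Ty L} (M : Tm Γ A) : TmEq M M
  | symm {Γ : Ctx L} {A : Ty L} {M N : Tm Γ A} : TmEq M N → TmEq N M
  | trans {Γ : Ctx L} {A : Ty L} {M N P : Tm Γ A} : TmEq M N → TmEq N P → TmEq M P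
  -- congruence
  | ite {Γ : Ctx L} {C : Ty L} {M M' : Tm Γ Ty.bool} {P P' Q Q' : Tm Γ C} :
      TmEq M M' → TmEq P P' → TmEq Q Q' → TmEq (Tm.ite M P Q) (Tm.ite M' P' Q')
  | pair {Γ : Ctx L} {A B : Ty L} {M M' : Tm Γ A} {N N' : Tm Γ B} :
      TmEq M M' → TmEq N N' → TmEq (Tm.pair M N) (Tm.pair M' N')
  | fst {Γ : Ctx L} {A B : Ty L} {M M' : Tm Γ (Ty.prod A B)} :
      TmEq M M' → TmEq (Tm.fst M) (Tm.fst M')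
  | snd {Γ : Ctx L} {A B : Ty L} {M M' : Tm Γ (Ty.prod A B)} :
      TmEq M M' → TmEq (Tm.snd M) (Tm.snd M')
  | lam {Γ : Ctx L} {A B : Ty L} {M M' : Tm (A :: Γ) B} :
      TmEq M M' → TmEq (Tm.lam M) (Tm.lam M')
  | app {Γ : Ctx L} {A B : Ty L} {M M' : Tm Γ (Ty.arrow A B)} {N N' : Tm Γ A} :
      TmEq M M' → TmEq N N' → TmEq (Tm.app M N) (Tm.app M' N')
  | ret {Γ : Ctx L} {A : Ty L} (ℓ : L) {M M' : Tm Γ A} :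
      TmEq M M' → TmEq (Tm.ret ℓ M) (Tm.ret ℓ M')
  | bind {Γ : Ctx L} {ℓ : L} {A B : Ty L} (h : Protected ℓ B)
      {M M' : Tm Γ (Ty.T ℓ A)} {N N' : Tm (A :: Γ) B} :
      TmEq M M' → TmEq N N' → TmEq (Tm.bind h M N) (Tm.bind h M' N')
  -- unit, products and functions
  | unit_eta {Γ : Ctx L} (M : Tm Γ Ty.unit) : TmEq M Tm.star
  | fst_beta {Γ : Ctx L} {A B : Ty L} (M : Tm Γ A) (N : Tm Γ B) :
      TmEq (Tm.fst (Tm.pair M N)) M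
  | snd_beta {Γ : Ctx L} {A B : Ty L} (M : Tm Γ A) (N : Tm Γ B) :
      TmEq (Tm.snd (Tm.pair M N)) N
  | pair_eta {Γ : Ctx L} {A B : Ty L} (M : Tm Γ (Ty.prod A B)) :
      TmEq (Tm.pair (Tm.fst M) (Tm.snd M)) M
  | lam_beta {Γ : Ctx L} {A B : Ty L} (M : Tm (A :: Γ) B) (N : Tm Γ A) :
      TmEq (Tm.app (Tm.lam M) N) (M.inst N)
  | lam_eta {Γ : Ctx L} {A B : Ty L} (M : Tm Γ (Ty.arrow A B)) :
      TmEq (Tm.lam (Tm.app (M.weaken A) (Tm.var Var.zero))) M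
  -- booleans
  | ite_tt {Γ : Ctx L} {C : Ty L} (P Q : Tm Γ C) : TmEq (Tm.ite Tm.tt P Q) P
  | ite_ff {Γ : Ctx L} {C : Ty L} (P Q : Tm Γ C) : TmEq (Tm.ite Tm.ff P Q) Q
  /-- `let x = [M]_ℓ in N` equals `N[M/x]` -/
  | bind_beta {Γ : Ctx L} {ℓ : L} {A B : Ty L} (h : Protected ℓ B)
      (M : Tm Γ A) (N : Tm (A :: Γ) B) :
      TmEq (Tm.bind h (Tm.ret ℓ M) N) (N.inst M)
  /-- `let x = M in [x]_ℓ` equals `M` -/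
  | bind_eta {Γ : Ctx L} {ℓ : L} {A : Ty L} (h : Protected ℓ (Ty.T ℓ A)) (M : Tm Γ (Ty.T ℓ A)) :
      TmEq (Tm.bind h M (Tm.ret ℓ (Tm.var Var.zero))) M
  /-- `let y = (let x = M in N) in P` equals `let x = M in (let y = N in P)`, provided that both
  sides are well typed -/
  | bind_assoc {Γ : Ctx L} {ℓ ℓ' : L} {A B C : Ty L} (h₁ : Protected ℓ (Ty.T ℓ' B))
      (h₂ : Protected ℓ' C) (h₃ : Protected ℓ C)
      (M : Tm Γ (Ty.T ℓ A)) (N : Tm (A :: Γ) (Ty.T ℓ' B)) (P : Tm (B :: Γ) C) :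
      TmEq (Tm.bind h₂ (Tm.bind h₁ M N) P)
        (Tm.bind h₃ M (Tm.bind h₂ N (P.rename (Ren.lift (Ren.wk A) B))))

end DCC

namespace DCC

universe v

/-! ### Composition laws for renamings and substitutions. -/

section SubstitutionLemmas

variable {L : Type v}

/-! The proof is by logical relations on closed terms. For an observer at level `k`, `Indist k`
relates everything at `T ℓ A` when `ℓ` is not below `k`; otherwise both terms must equal returns of
related contents. The crux is `Indist.of_protected`: a type protected at a level not below `k` has
the total relation, so a `bind` on a hidden computation reveals nothing. Hence every term maps
related substitutions to related results (`Indist.subst`). With `k = ℓ'`, the inputs `E` and `E'`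
are related for free, and relatedness at `T ℓ' bool` forces provable equality.

Totality at `T ℓ' A` with `ℓ'` below `k` needs every closed term there to equal a return; a unary
relation, `Computable`, supplies this canonicity. -/

theorem Ren.lift_comp {Γ Δ Θ : Ctx L} (ρ : Ren Γ Δ) (ρ' : Ren Δ Θ) (B : Ty L) :
    (fun A v => ρ'.lift B A (ρ.lift B A v)) = Ren.lift (fun A v => ρ' A (ρ A v)) B := by
  funext A v
  cases v <;> rfl

variable [LE L]

theorem Tm.rename_rename {Γ Δ Θ : Ctx L} {A : Ty L} (M : Tm Γ A) (ρ : Ren Γ Δ) (ρ' : Ren Δ Θ) :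
    (M.rename ρ).rename ρ' = M.rename (fun A v => ρ' A (ρ A v)) := by
  induction M generalizing Δ Θ with
  | var | star | tt | ff => rfl
  | fst _ ih | snd _ ih | ret _ _ ih => simp only [Tm.rename, ih]
  | pair _ _ ih₁ ih₂ | app _ _ ih₁ ih₂ => simp only [Tm.rename, ih₁, ih₂]
  | ite _ _ _ ih₁ ih₂ ih₃ => simp only [Tm.rename, ih₁, ih₂, ih₃]
  | lam _ ih => simp only [Tm.rename, ih, Ren.lift_comp]
  | bind _ _ _ ih₁ ih₂ => simp only [Tm.rename, ih₁, ih₂, Ren.lift_comp]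

theorem Sub.lift_ren_comp {Γ Δ Θ : Ctx L} (ρ : Ren Γ Δ) (σ : Sub Δ Θ) (B : Ty L) :
    (fun A v => σ.lift B A (ρ.lift B A v)) = Sub.lift (fun A v => σ A (ρ A v)) B := by
  funext A v
  cases v <;> rfl

theorem Tm.subst_rename {Γ Δ Θ : Ctx L} {A : Ty L} (M : Tm Γ A) (ρ : Ren Γ Δ) (σ : Sub Δ Θ) :
    (M.rename ρ).subst σ = M.subst (fun A v => σ A (ρ A v)) := by
  induction M generalizing Δ Θ with
  | var | star | tt | ff => rfl
  | fst _ ih | snd _ ih | ret _ _ ih => simp only [Tm.rename, Tm.subst, ih]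
  | pair _ _ ih₁ ih₂ | app _ _ ih₁ ih₂ => simp only [Tm.rename, Tm.subst, ih₁, ih₂]
  | ite _ _ _ ih₁ ih₂ ih₃ => simp only [Tm.rename, Tm.subst, ih₁, ih₂, ih₃]
  | lam _ ih => simp only [Tm.rename, Tm.subst, ih, Sub.lift_ren_comp]
  | bind _ _ _ ih₁ ih₂ => simp only [Tm.rename, Tm.subst, ih₁, ih₂, Sub.lift_ren_comp]

theorem Sub.lift_comp_ren {Γ Δ Θ : Ctx L} (σ : Sub Γ Δ) (ρ : Ren Δ Θ) (B : Ty L) :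
    (fun A v => (σ.lift B A v).rename (ρ.lift B)) =
      Sub.lift (fun A v => (σ A v).rename ρ) B := by
  funext A v
  cases v with
  | zero => rfl
  | succ v => simp only [Sub.lift, Tm.weaken, Tm.rename_rename]; rfl

theorem Tm.rename_subst {Γ Δ Θ : Ctx L} {A : Ty L} (M : Tm Γ A) (σ : Sub Γ Δ) (ρ : Ren Δ Θ) :
    (M.subst σ).rename ρ = M.subst (fun A v => (σ A v).rename ρ) := by
  induction M generalizing Δ Θ with
  | var | star | tt | ff => rfl
  | fst _ ih | snd _ ih | ret _ _ ih => simp only [Tm.rename, Tm.subst, ih]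
  | pair _ _ ih₁ ih₂ | app _ _ ih₁ ih₂ => simp only [Tm.rename, Tm.subst, ih₁, ih₂]
  | ite _ _ _ ih₁ ih₂ ih₃ => simp only [Tm.rename, Tm.subst, ih₁, ih₂, ih₃]
  | lam _ ih => simp only [Tm.rename, Tm.subst, ih, Sub.lift_comp_ren]
  | bind _ _ _ ih₁ ih₂ => simp only [Tm.rename, Tm.subst, ih₁, ih₂, Sub.lift_comp_ren]

theorem Sub.lift_comp {Γ Δ Θ : Ctx L} (σ : Sub Γ Δ) (τ : Sub Δ Θ) (B : Ty L) :
    (fun A v => (σ.lift B A v).subst (τ.lift B)) =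
      Sub.lift (fun A v => (σ A v).subst τ) B := by
  funext A v
  cases v with
  | zero => rfl
  | succ v => simp only [Sub.lift, Tm.weaken, Tm.rename_subst, Tm.subst_rename]; rfl

/-- Lifting a substitution weakens its terms, so the binder cases rest on both mixed laws for
renaming and substitution. -/
theorem Tm.subst_subst {Γ Δ Θ : Ctx L} {A : Ty L} (M : Tm Γ A) (σ : Sub Γ Δ) (τ : Sub Δ Θ) :
    (M.subst σ).subst τ = M.subst (fun A v => (σ A v).subst τ) := by
  induction M generalizing Δ Θ with
  | var | star | tt | ff => rfl
  | fst _ ih | snd _ ih | ret _ _ ih => simp only [Tm.subst, ih]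
  | pair _ _ ih₁ ih₂ | app _ _ ih₁ ih₂ => simp only [Tm.subst, ih₁, ih₂]
  | ite _ _ _ ih₁ ih₂ ih₃ => simp only [Tm.subst, ih₁, ih₂, ih₃]
  | lam _ ih => simp only [Tm.subst, ih, Sub.lift_comp]
  | bind _ _ _ ih₁ ih₂ => simp only [Tm.subst, ih₁, ih₂, Sub.lift_comp]

theorem Sub.lift_var {Γ : Ctx L} (B : Ty L) :
    Sub.lift (fun A (v : Var Γ A) => Tm.var v) B = fun _ v => Tm.var v := by
  funext A v
  cases v <;> rfl

theorem Tm.subst_var {Γ : Ctx L} {A : Ty L} (M : Tm Γ A) :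
    M.subst (fun _ v => Tm.var v) = M := by
  induction M <;> simp_all [Tm.subst, Sub.lift_var]

/-- Extend a substitution by a term for the most recent variable. -/
def Sub.cons {Γ Δ : Ctx L} {B : Ty L} (σ : Sub Γ Δ) (N : Tm Δ B) : Sub (B :: Γ) Δ
  | _, Var.zero => N
  | A, Var.succ v => σ A v

/-- Turns the contractum of a β-step into a single substitution, the form to which induction
hypotheses for bodies apply. -/
theorem Tm.inst_subst_lift {Γ Δ : Ctx L} {A B : Ty L} (M : Tm (B :: Γ) A) (σ : Sub Γ Δ)
    (N : Tm Δ B) : (M.subst (σ.lift B)).inst N = M.subst (σ.cons N) := by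
  rw [Tm.inst, Tm.subst_subst]
  congr 1
  funext A v
  cases v with
  | zero => rfl
  | succ v =>
    simp only [Sub.lift, Tm.weaken, Tm.subst_rename]
    exact Tm.subst_var _

end SubstitutionLemmas

/-! ### Canonicity of closed terms. -/

section Computability

variable {L : Type v} [LE L]

/-- The boolean constant `tt` or `ff`. -/
def Tm.ofBool {Γ : Ctx L} : Bool → Tm Γ Ty.bool
  | true => Tm.tt
  | false => Tm.ff

theorem TmEq.ite_ofBool {Γ : Ctx L} {C : Ty L} {M : Tm Γ Ty.bool} {b : Bool}
    (h : TmEq M (Tm.ofBool b)) (P Q : Tm Γ C) : TmEq (Tm.ite M P Q) (bif b then P else Q) := by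
  refine (TmEq.ite h (.refl P) (.refl Q)).trans ?_
  cases b
  · exact .ite_ff P Q
  · exact .ite_tt P Q

theorem TmEq.app_lam_subst {Γ Δ : Ctx L} {A B : Ty L} (M : Tm (A :: Γ) B) (σ : Sub Γ Δ)
    (N : Tm Δ A) : TmEq (Tm.app ((Tm.lam M).subst σ) N) (M.subst (σ.cons N)) := by
  rw [← Tm.inst_subst_lift]
  exact .lam_beta _ _

theorem TmEq.bind_subst {Γ Δ : Ctx L} {ℓ : L} {A B : Ty L} (h : Protected ℓ B)
    {M : Tm Γ (Ty.T ℓ A)} {M' : Tm Δ A} (N : Tm (A :: Γ) B) (σ : Sub Γ Δ)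
    (hM : TmEq (M.subst σ) (Tm.ret ℓ M')) :
    TmEq ((Tm.bind h M N).subst σ) (N.subst (σ.cons M')) := by
  rw [← Tm.inst_subst_lift]
  exact (TmEq.bind h hM (.refl _)).trans (.bind_beta h _ _)

/-- Hereditary computability of closed terms. -/
def Computable : (A : Ty L) → Tm [] A → Prop
  | .unit, _ => True
  | .bool, M => ∃ b, TmEq M (Tm.ofBool b)
  | .prod A B, M => Computable A M.fst ∧ Computable B M.snd
  | .arrow A B, M => ∀ N, Computable A N → Computable B (M.app N)
  | .T ℓ A, M => ∃ M', TmEq M (Tm.ret ℓ M') ∧ Computable A M'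

theorem Computable.of_tmEq {A : Ty L} {M N : Tm [] A} (h : TmEq M N) (hN : Computable A N) :
    Computable A M := by
  induction A with
  | unit => trivial
  | bool => exact hN.imp fun _ hb => h.trans hb
  | prod A B ihA ihB => exact ⟨ihA (.fst h) hN.1, ihB (.snd h) hN.2⟩
  | arrow A B _ ihB => exact fun P hP => ihB (.app h (.refl P)) (hN P hP)
  | T ℓ A _ => exact hN.imp fun _ hb => ⟨h.trans hb.1, hb.2⟩

/-- Fundamental lemma, by induction on the term: each β-redex is replaced by its contractum, as
computability is invariant under `TmEq`. -/
theorem Computable.subst {Γ : Ctx L} {A : Ty L} (M : Tm Γ A) (σ : Sub Γ [])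
    (hσ : ∀ B v, Computable B (σ B v)) : Computable A (M.subst σ) := by
  have cons : ∀ {Γ : Ctx L} {B : Ty L} {σ : Sub Γ []} {N : Tm [] B},
      (∀ C v, Computable C (σ C v)) → Computable B N → ∀ C v, Computable C (σ.cons N C v) := by
    intro Γ B σ N hσ hN C v
    cases v with
    | zero => exact hN
    | succ v => exact hσ C v
  induction M with
  | var v => exact hσ _ v
  | star => trivial
  | tt => exact ⟨true, .refl _⟩
  | ff => exact ⟨false, .refl _⟩
  | ite M P Q ihM ihP ihQ =>
    obtain ⟨b, hb⟩ := ihM σ hσ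
    refine .of_tmEq (.ite_ofBool hb _ _) ?_
    cases b
    · exact ihQ σ hσ
    · exact ihP σ hσ
  | pair M N ihM ihN =>
    exact ⟨.of_tmEq (.fst_beta _ _) (ihM σ hσ), .of_tmEq (.snd_beta _ _) (ihN σ hσ)⟩
  | fst M ih => exact (ih σ hσ).1
  | snd M ih => exact (ih σ hσ).2
  | lam M ih => exact fun N hN => .of_tmEq (.app_lam_subst M σ N) (ih _ (cons hσ hN))
  | app M N ihM ihN => exact ihM σ hσ _ (ihN σ hσ)
  | ret ℓ M ih => exact ⟨_, .refl _, ih σ hσ⟩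
  | bind h M N ihM ihN =>
    obtain ⟨M', hM, hM'⟩ := ihM σ hσ
    exact .of_tmEq (.bind_subst h N σ hM) (ihN _ (cons hσ hM'))

theorem Computable.of_closed {A : Ty L} (M : Tm [] A) : Computable A M := by
  rw [← M.subst_var]
  exact .subst M _ nofun

end Computability

/-! ### The binary logical relation. -/

section Indistinguishability

variable {L : Type v} [Preorder L]

/-- Indistinguishability of closed terms for an observer at level `k`: contents above levels
not below `k` are not observable. -/
def Indist (k : L) : (A : Ty L) → Tm [] A → Tm [] A → Prop
  | .unit, _, _ => True
  | .bool, M, N => ∃ b, TmEq M (Tm.ofBool b) ∧ TmEq N (Tm.ofBool b)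
  | .prod A B, M, N => Indist k A M.fst N.fst ∧ Indist k B M.snd N.snd
  | .arrow A B, M, N => ∀ P Q, Indist k A P Q → Indist k B (M.app P) (N.app Q)
  | .T ℓ A, M, N => ℓ ≤ k →
      ∃ M' N', TmEq M (Tm.ret ℓ M') ∧ TmEq N (Tm.ret ℓ N') ∧ Indist k A M' N'

theorem Indist.of_tmEq {k : L} {A : Ty L} {M M' N N' : Tm [] A} (hM : TmEq M M')
    (hN : TmEq N N') (h : Indist k A M' N') : Indist k A M N := by
  induction A with
  | unit => trivial
  | bool => exact h.imp fun _ hb => ⟨hM.trans hb.1, hN.trans hb.2⟩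
  | prod A B ihA ihB =>
    exact ⟨ihA (.fst hM) (.fst hN) h.1, ihB (.snd hM) (.snd hN) h.2⟩
  | arrow A B _ ihB =>
    exact fun P Q hPQ => ihB (.app hM (.refl P)) (.app hN (.refl Q)) (h P Q hPQ)
  | T ℓ A _ =>
    intro hℓ
    obtain ⟨P, Q, hP, hQ, hPQ⟩ := h hℓ
    exact ⟨P, Q, hM.trans hP, hN.trans hQ, hPQ⟩

/-- Induction on protection: it ends at a `T` whose level is not below `k`, where the relation is
vacuous, and the other clauses preserve totality. -/
theorem Indist.of_protected {k ℓ : L} (hℓ : ¬ ℓ ≤ k) {A : Ty L} (hA : Protected ℓ A)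
    (M N : Tm [] A) : Indist k A M N := by
  induction hA with
  | level h => exact fun h' => absurd (h.trans h') hℓ
  | inner _ ih =>
    -- The outer level is visible, so actual returns are required; canonicity provides them.
    intro _
    obtain ⟨M', hM, -⟩ := Computable.of_closed M
    obtain ⟨N', hN, -⟩ := Computable.of_closed N
    exact ⟨M', N', hM, hN, ih hℓ M' N'⟩
  | prod _ _ ihA ihB => exact ⟨ihA hℓ _ _, ihB hℓ _ _⟩
  | arrow _ ih => exact fun P Q _ => ih hℓ _ _

theorem Indist.subst {k : L} {Γ : Ctx L} {A : Ty L} (M : Tm Γ A) (σ τ : Sub Γ [])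
    (h : ∀ B v, Indist k B (σ B v) (τ B v)) : Indist k A (M.subst σ) (M.subst τ) := by
  have cons : ∀ {Γ : Ctx L} {B : Ty L} {σ τ : Sub Γ []} {P Q : Tm [] B},
      (∀ C v, Indist k C (σ C v) (τ C v)) → Indist k B P Q →
        ∀ C v, Indist k C (σ.cons P C v) (τ.cons Q C v) := by
    intro Γ B σ τ P Q h hPQ C v
    cases v with
    | zero => exact hPQ
    | succ v => exact h C v
  induction M with
  | var v => exact h _ v
  | star => trivial
  | tt => exact ⟨true, .refl _, .refl _⟩
  | ff => exact ⟨false, .refl _, .refl _⟩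
  | ite M P Q ihM ihP ihQ =>
    obtain ⟨b, hb, hb'⟩ := ihM σ τ h
    refine .of_tmEq (.ite_ofBool hb _ _) (.ite_ofBool hb' _ _) ?_
    cases b
    · exact ihQ σ τ h
    · exact ihP σ τ h
  | pair M N ihM ihN =>
    exact ⟨.of_tmEq (.fst_beta _ _) (.fst_beta _ _) (ihM σ τ h),
      .of_tmEq (.snd_beta _ _) (.snd_beta _ _) (ihN σ τ h)⟩
  | fst M ih => exact (ih σ τ h).1
  | snd M ih => exact (ih σ τ h).2
  | lam M ih =>
    exact fun P Q hPQ =>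
      .of_tmEq (.app_lam_subst M σ P) (.app_lam_subst M τ Q) (ih _ _ (cons h hPQ))
  | app M N ihM ihN => exact ihM σ τ h _ _ (ihN σ τ h)
  | ret ℓ M ih => exact fun _ => ⟨_, _, .refl _, .refl _, ih σ τ h⟩
  | @bind _ ℓ _ _ hB M N ihM ihN =>
    -- A visible computation yields related contents to substitute into the body; for a hidden one,
    -- protection of the result type suffices.
    by_cases hℓ : ℓ ≤ k
    · obtain ⟨P, Q, hP, hQ, hPQ⟩ := ihM σ τ h hℓ
      exact .of_tmEq (.bind_subst hB N σ hP) (.bind_subst hB N τ hQ) (ihN _ _ (cons h hPQ))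
    · exact .of_protected hℓ hB _ _

end Indistinguishability

end DCC

theorem mainTheorem7 {L : Type*} [Lattice L] (ℓ ℓ' : L) (hℓ : ¬ ℓ ≤ ℓ') (A : DCC.Ty L)
    (hA : Nonempty (DCC.Tm [] A))
    (M : DCC.Tm [DCC.Ty.T ℓ A] (DCC.Ty.T ℓ' DCC.Ty.bool))
    (E E' : DCC.Tm [] (DCC.Ty.T ℓ A)) :
    DCC.TmEq (M.inst E) (M.inst E') := by
  have hE : ∀ B v, DCC.Indist ℓ' B (DCC.Sub.single E B v) (DCC.Sub.single E' B v) := by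
    intro B v
    cases v with
    | zero => exact fun h => absurd h hℓ
    | succ v => nomatch v
  -- The result type sits at the observer's own level, so `le_rfl` unlocks its clause, and both
  -- contents equal the same boolean.
  obtain ⟨P, Q, hP, hQ, b, hb, hb'⟩ := DCC.Indist.subst M _ _ hE le_rfl
  exact hP.trans ((DCC.TmEq.ret ℓ' (hb.trans hb'.symm)).trans hQ.symm)
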